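/- **Theorem (Euler's formula).** A *polyhedron* $P$ in $\mathbb{R}^3$ is a surface given by a finite nonempty collection of convex polygons (closed, filled, two-dimensional), called its faces, such that any two distinct faces are disjoint or meet exactly in a common vertex or a common edge, every edge of a face is an edge of exactly two faces, and every vertex of a face is an endpoint of at least three edges. The edges and vertices of $P$ are those of its faces. The polyhedron is *convex* if, for each face $f$, the union of all the faces lies in one of the two closed half-spaces bounded by the plane containing $f$. Let $P$ be a convex polyhedron in $\mathbb{R}^3$ with $n_0$ vertices, $n_1$ edges and $n_2$ (two-dimensional) faces. Then $$n_0 - n_1 + n_2 = 2.$$ -/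

import Mathlib

/-- Euclidean three-space. -/
abbrev E3 : Type := EuclideanSpace ℝ (Fin 3)

/-- A (nondegenerate, closed, filled) convex polygon in `ℝ³`: the convex hull of finitely many
points, of affine dimension two. -/
def IsConvexPolygon (f : Set E3) : Prop :=
  (∃ s : Set E3, s.Finite ∧ f = convexHull ℝ s) ∧ Module.finrank ℝ (vectorSpan ℝ f) = 2

/-- The vertices of a convex polygon: its extreme points. -/
def polygonVertices (f : Set E3) : Set E3 := f.extremePoints ℝ

/-- The edges (sides) of a convex polygon: the nondegenerate closed segments which are
extreme subsets (faces) of it. -/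
def polygonEdges (f : Set E3) : Set (Set E3) :=
  {e | ∃ x y : E3, x ≠ y ∧ e = segment ℝ x y ∧ IsExtreme ℝ f e}

/-- A polyhedron in `ℝ³`, understood as a surface made of polygonal faces. -/
structure Polyhedron where
  /-- the two-dimensional faces -/
  faces : Finset (Set E3)
  faces_nonempty : faces.Nonempty
  isConvexPolygon_of_mem : ∀ f ∈ faces, IsConvexPolygon f
  /-- Two distinct faces are disjoint, or meet exactly in a common vertex or in a common edge. -/
  inter_of_ne : ∀ f ∈ faces, ∀ g ∈ faces, f ≠ g →
    f ∩ g = ∅ ∨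
    (∃ v ∈ polygonVertices f ∩ polygonVertices g, f ∩ g = {v}) ∨
    f ∩ g ∈ polygonEdges f ∩ polygonEdges g
  /-- Every edge is an edge of exactly two faces. -/
  two_faces_of_edge : ∀ e ∈ ⋃ f ∈ faces, polygonEdges f,
    {f | f ∈ faces ∧ e ∈ polygonEdges f}.ncard = 2
  /-- Every vertex is an endpoint of at least three edges. -/
  three_edges_of_vertex : ∀ v ∈ ⋃ f ∈ faces, polygonVertices f,
    3 ≤ {e | e ∈ (⋃ f ∈ faces, polygonEdges f) ∧ v ∈ e.extremePoints ℝ}.ncard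

namespace Polyhedron

/-- The vertices of a polyhedron. -/
def vertices (P : Polyhedron) : Set E3 := ⋃ f ∈ P.faces, polygonVertices f

/-- The edges of a polyhedron. -/
def edges (P : Polyhedron) : Set (Set E3) := ⋃ f ∈ P.faces, polygonEdges f

/-- The surface: the union of the faces. -/
def surface (P : Polyhedron) : Set E3 := ⋃ f ∈ P.faces, f

/-- A polyhedron is convex if, for each face, it lies in one of the two closed half-spaces
bounded by the plane `{x | l x = c}` of this face. -/
def IsConvex (P : Polyhedron) : Prop :=
  ∀ f ∈ P.faces, ∃ (l : E3 →L[ℝ] ℝ) (c : ℝ), l ≠ 0 ∧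
    (∀ x ∈ f, l x = c) ∧ ∀ x ∈ P.surface, l x ≤ c

/-- There are finitely many vertices, so that `Set.ncard` counts them. -/
theorem finite_vertices (P : Polyhedron) : P.vertices.Finite := by
  refine P.faces.finite_toSet.biUnion fun f hf => ?_
  obtain ⟨⟨s, hs, rfl⟩, -⟩ := P.isConvexPolygon_of_mem f hf
  exact hs.subset extremePoints_convexHull_subset

/-- There are finitely many edges, so that `Set.ncard` counts them. -/
theorem finite_edges (P : Polyhedron) : P.edges.Finite := by
  refine P.faces.finite_toSet.biUnion fun f hf => ?_
  have hV : (polygonVertices f).Finite := by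
    obtain ⟨⟨s, hs, rfl⟩, -⟩ := P.isConvexPolygon_of_mem f hf
    exact hs.subset extremePoints_convexHull_subset
  refine ((hV.prod hV).image fun p : E3 × E3 => segment ℝ p.1 p.2).subset ?_
  rintro e ⟨x, y, -, rfl, he⟩
  have key : ∀ a b : E3, a ∈ (segment ℝ a b).extremePoints ℝ := by
    intro a b
    refine ⟨left_mem_segment ℝ a b, ?_⟩
    rintro u hu w hw ⟨p, q, hp, hq, hpq, h⟩
    rw [segment_eq_image'] at hu hw
    obtain ⟨t, ⟨ht0, -⟩, rfl⟩ := hu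
    obtain ⟨r, ⟨hr0, -⟩, rfl⟩ := hw
    have h1 : (p * t + q * r) • (b - a) = 0 := by
      have h2 : p • (a + t • (b - a)) + q • (a + r • (b - a))
          = (p + q) • a + (p * t + q * r) • (b - a) := by module
      simp only at h
      rw [h2, hpq, one_smul] at h
      simpa using h
    rcases smul_eq_zero.mp h1 with h3 | h3
    · have : t = 0 := by
        have h4 := mul_nonneg hp.le ht0
        have h5 := mul_nonneg hq.le hr0
        have h6 : p * t = 0 := by linarith
        exact (mul_eq_zero.mp h6).resolve_left hp.ne'
      simp [this]
    · simp [h3]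
  refine ⟨(x, y), ⟨?_, ?_⟩, rfl⟩
  · exact he.extremePoints_subset_extremePoints (key x y)
  · refine he.extremePoints_subset_extremePoints ?_
    rw [segment_symm]
    exact key y x

end Polyhedron

/-! Sweep the polyhedron with a linear functional `h` that takes distinct values at the vertices,
and count in two ways the pairs of a face and a vertex of it that is neither its lowest nor its
highest ("middle"). A `k`-gon has `k - 2` middle vertices, and every edge lies on two faces, so the
count is `2 * n₁ - 2 * n₂`. On the other side, the highest and lowest vertices of the polyhedron are
middle in no face, and every other vertex is middle in exactly two; so the count is `2 * (n₀ - 2)`.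
Equating the two gives the formula.

The substance is "exactly two" (`ncard_midVertices_eq_two`), which has three ingredients. The number
is even (`even_ncard_midVertices`), by counting descending edges face by face. It is at most two
(`ncard_midVertices_le_two`): in the horizontal plane through the vertex, each middle face leaves
along a ray lying on a line that supports all the others, and no three distinct rays allow this. It
is not zero (`le_of_forall_notMem_midVertices`): otherwise the faces having a descending edge at the
vertex close up below it, and convexity makes the vertex a highest point, or a lowest one after
replacing `h` by `-h`. -/

/-- A linear functional which is injective on a given finite set. -/
theorem exists_dual_injOn {s : Set E3} (hs : s.Finite) :
    ∃ τ : Module.Dual ℝ E3, Set.InjOn τ s := by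
  have : Finite {p : E3 × E3 // (p.1 ∈ s ∧ p.2 ∈ s) ∧ p.1 ≠ p.2} :=
    ((hs.prod hs).subset (fun p (hp : (p.1 ∈ s ∧ p.2 ∈ s) ∧ p.1 ≠ p.2) => ⟨hp.1.1, hp.1.2⟩)).to_subtype
  obtain ⟨τ, hτ⟩ := Module.exists_dual_forall_apply_ne_zero (K := ℝ)
    (fun p : {p : E3 × E3 // (p.1 ∈ s ∧ p.2 ∈ s) ∧ p.1 ≠ p.2} => p.1.1 - p.1.2)
    (fun p => sub_ne_zero.mpr p.2.2)
  refine ⟨τ, fun x hx y hy hxy => ?_⟩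
  by_contra hne
  refine hτ ⟨(x, y), ⟨hx, hy⟩, hne⟩ ?_
  simp [map_sub, hxy]

/-! ### Convex polygons and their extreme points -/

namespace IsConvexPolygon

variable {f : Set E3}

theorem convex (hf : IsConvexPolygon f) : Convex ℝ f := by
  obtain ⟨⟨s, hs, rfl⟩, -⟩ := hf
  exact convex_convexHull ℝ s

theorem finite_vertices (hf : IsConvexPolygon f) : (polygonVertices f).Finite := by
  obtain ⟨⟨s, hs, rfl⟩, -⟩ := hf
  exact hs.subset extremePoints_convexHull_subset

/-- Krein–Milman; no closure is needed because the hull of finitely many points is already closed.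
-/
theorem convexHull_vertices (hf : IsConvexPolygon f) : convexHull ℝ (polygonVertices f) = f := by
  have h1 : IsCompact f := by
    obtain ⟨⟨s, hs, rfl⟩, -⟩ := hf
    exact hs.isCompact_convexHull ℝ
  have h2 := closure_convexHull_extremePoints h1 hf.convex
  have h3 : IsClosed (convexHull ℝ (f.extremePoints ℝ)) :=
    hf.finite_vertices.isClosed_convexHull ℝ
  rwa [h3.closure_eq] at h2

theorem subset_of_vertices_subset (hf : IsConvexPolygon f) {C : Set E3} (hC : Convex ℝ C)
    (h : polygonVertices f ⊆ C) : f ⊆ C := by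
  rw [← hf.convexHull_vertices]
  exact convexHull_min h hC

/-- A polygon is not contained in a line. -/
theorem exists_vertex_not_mem_span (hf : IsConvexPolygon f) (v p : E3) :
    ∃ x ∈ polygonVertices f, x - v ∉ Submodule.span ℝ {p} := by
  by_contra! h
  have h1 : ∀ x ∈ f, x - v ∈ Submodule.span ℝ {p} := by
    refine hf.subset_of_vertices_subset (C := {x | x - v ∈ Submodule.span ℝ {p}}) ?_ h
    intro x hx y hy s t _ _ hst
    have : s • x + t • y - v = s • (x - v) + t • (y - v) := by
      have : v = (s + t) • v := by rw [hst, one_smul]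
      nth_rw 1 [this]
      module
    rw [Set.mem_ofPred_eq, this]
    exact add_mem (Submodule.smul_mem _ _ hx) (Submodule.smul_mem _ _ hy)
  have h2 : vectorSpan ℝ f ≤ Submodule.span ℝ {p} := by
    refine Submodule.span_le.mpr ?_
    rintro _ ⟨x, hx, y, hy, rfl⟩
    have := sub_mem (h1 x hx) (h1 y hy)
    simpa using this
  have h3 := Submodule.finrank_mono h2
  have h4 := finrank_span_le_card (R := ℝ) ({p} : Set E3)
  rw [hf.2] at h3
  simp at h4
  omega

end IsConvexPolygon

/-- Two extreme points on the same ray from an extreme point coincide. -/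
theorem eq_of_extremePoints_of_ray {f : Set E3} {v x y : E3} (hv : v ∈ f.extremePoints ℝ)
    (hx : x ∈ f.extremePoints ℝ) (hy : y ∈ f.extremePoints ℝ) (hxv : x ≠ v) {c : ℝ} (hc : 0 < c)
    (h : y - v = c • (x - v)) : c = 1 ∧ y = x := by
  have hy' : y = v + c • (x - v) := by rw [← h]; abel
  rcases lt_trichotomy c 1 with h1 | h1 | h1
  · exfalso
    have : v = y := hy.2 hv.1 hx.1 ⟨1 - c, c, by linarith, hc, by ring, by rw [hy']; module⟩
    rw [← this, sub_self] at h
    exact hxv (sub_eq_zero.mp ((smul_eq_zero.mp h.symm).resolve_left hc.ne'))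
  · subst h1
    exact ⟨rfl, by simpa using hy'⟩
  · exfalso
    refine hxv (hx.2 hv.1 hy.1 ⟨1 - c⁻¹, c⁻¹, ?_, by positivity, by ring, ?_⟩).symm
    · have := inv_lt_one_of_one_lt₀ h1
      linarith
    · have h2 : c⁻¹ * c = 1 := inv_mul_cancel₀ hc.ne'
      have h3 : (1 - c⁻¹) • v + c⁻¹ • y = v + (c⁻¹ * c) • (x - v) := by rw [hy']; module
      rw [h3, h2]
      module

/-! ### The angle of a polygon at a vertex -/

/-- The polygon `f` lies in the angle at `v` spanned by its vertices `a` and `b`. -/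
structure PolygonCorner (f : Set E3) (v a b : E3) : Prop where
  left_mem : a ∈ polygonVertices f
  right_mem : b ∈ polygonVertices f
  indep : ∀ s t : ℝ, s • (a - v) + t • (b - v) = 0 → s = 0 ∧ t = 0
  cone : ∀ x ∈ f, ∃ s t : ℝ, 0 ≤ s ∧ 0 ≤ t ∧ x = v + (s • (a - v) + t • (b - v))

/-- A functional `g` separates `v` from the hull of the other vertices. Projecting these from `v` to
the level `g = -1` of direction space puts them on a line, because the polygon is two-dimensional;
the two ends of the projected set give the sides of the angle. -/
theorem IsConvexPolygon.exists_polygonCorner {f : Set E3} (hf : IsConvexPolygon f) {v : E3}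
    (hv : v ∈ polygonVertices f) : ∃ a b, PolygonCorner f v a b := by
  set S := polygonVertices f \ {v} with hS
  have hSfin : S.Finite := hf.finite_vertices.subset Set.sdiff_subset
  have hSne : S.Nonempty := by
    obtain ⟨x, hx, hx'⟩ := hf.exists_vertex_not_mem_span v 0
    refine ⟨x, hx, fun h => hx' ?_⟩
    rw [Set.mem_singleton_iff] at h
    simp [h]
  have hvS : v ∉ convexHull ℝ S := fun h =>
    ((hf.convex.mem_extremePoints_iff_mem_sdiff_convexHull_sdiff).mp hv).2
      (convexHull_mono (Set.sdiff_subset_sdiff_left extremePoints_subset) h)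
  obtain ⟨g, u, hg1, hg2⟩ := geometric_hahn_banach_closed_point (convex_convexHull ℝ S)
    (hSfin.isClosed_convexHull ℝ) hvS
  have hg : ∀ x ∈ S, 0 < g v - g x := fun x hx => by
    have := hg1 x (subset_convexHull ℝ S hx)
    linarith
  set p : E3 → E3 := fun x => (g v - g x)⁻¹ • (x - v) with hp
  have hxp : ∀ x ∈ S, x - v = (g v - g x) • p x := fun x hx => by
    rw [hp, smul_smul, mul_inv_cancel₀ (hg x hx).ne', one_smul]
  have hgp : ∀ x ∈ S, g (p x) = -1 := fun x hx => by
    have := (hg x hx).ne'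
    simp only [hp, map_smul, map_sub, smul_eq_mul]
    field_simp
    ring
  -- `τ` serves as a coordinate on that line; injectivity ensures that its maximum and minimum
  -- coincide only if all vertices are collinear with `v`.
  obtain ⟨τ, hτ⟩ := exists_dual_injOn (hSfin.image p)
  obtain ⟨a, ha, hamax⟩ := Set.exists_max_image S (fun x => τ (p x)) hSfin hSne
  obtain ⟨b, hb, hbmin⟩ := Set.exists_min_image S (fun x => τ (p x)) hSfin hSne
  have hab : τ (p b) < τ (p a) := by
    refine lt_of_le_of_ne (hamax b hb) fun heq => ?_
    obtain ⟨x, hx, hx'⟩ := hf.exists_vertex_not_mem_span v (p a)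
    by_cases hxv : x = v
    · simp [hxv] at hx'
    have hxS : x ∈ S := ⟨hx, hxv⟩
    have : p x = p a := hτ (Set.mem_image_of_mem p hxS) (Set.mem_image_of_mem p ha)
      (le_antisymm (hamax x hxS) (heq ▸ hbmin x hxS))
    refine hx' (Submodule.mem_span_singleton.mpr ⟨g v - g x, ?_⟩)
    rw [← this, ← hxp x hxS]
  have hind : ∀ s t : ℝ, s • p a + t • p b = 0 → s = 0 ∧ t = 0 := by
    intro s t h
    have h1 := congrArg g h
    have h2 := congrArg τ h
    simp only [map_add, map_smul, smul_eq_mul, map_zero, hgp a ha, hgp b hb] at h1 h2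
    have h3 : t = -s := by linarith
    subst h3
    have h4 : s * (τ (p a) - τ (p b)) = 0 := by linarith
    have h5 : s = 0 := (mul_eq_zero.mp h4).resolve_right (by linarith)
    simp [h5]
  have hpmem : ∀ x ∈ S, p x ∈ vectorSpan ℝ f := fun x hx =>
    Submodule.smul_mem _ _ (vsub_mem_vectorSpan ℝ hx.1.1 hv.1)
  have hspan : Submodule.span ℝ {p a, p b} = vectorSpan ℝ f := by
    refine Submodule.eq_of_le_of_finrank_eq ?_ ?_
    · rw [Submodule.span_le]
      rintro _ (rfl | rfl)
      exacts [hpmem a ha, hpmem b hb]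
    · rw [hf.2]
      have h1 : LinearIndependent ℝ ![p a, p b] := LinearIndependent.pair_iff.mpr hind
      have h2 := finrank_span_eq_card h1
      rw [Matrix.range_cons_cons_empty] at h2
      simpa using h2
  have hcomb : ∀ x ∈ S, ∃ s t : ℝ, 0 ≤ s ∧ 0 ≤ t ∧ p x = s • p a + t • p b := by
    intro x hx
    have h1 := hpmem x hx
    rw [← hspan, Submodule.mem_span_pair] at h1
    obtain ⟨s, t, hst⟩ := h1
    have h1 := congrArg g hst
    have h2 := congrArg τ hst
    simp only [map_add, map_smul, smul_eq_mul, hgp a ha, hgp b hb, hgp x hx] at h1 h2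
    have h3 := hamax x hx
    have h4 := hbmin x hx
    refine ⟨s, t, ?_, ?_, hst.symm⟩
    · have h5 : 0 ≤ s * (τ (p a) - τ (p b)) := by
        have : t = 1 - s := by linarith
        subst this
        linarith
      exact nonneg_of_mul_nonneg_left h5 (by linarith)
    · have h5 : 0 ≤ t * (τ (p a) - τ (p b)) := by
        have : s = 1 - t := by linarith
        subst this
        linarith
      exact nonneg_of_mul_nonneg_left h5 (by linarith)
  refine ⟨a, b, ha.1, hb.1, ?_, ?_⟩
  · intro s t h
    obtain ⟨h1, h2⟩ := hind (s * (g v - g a)) (t * (g v - g b))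
      (by rw [mul_smul, mul_smul, ← hxp a ha, ← hxp b hb, h])
    exact ⟨(mul_eq_zero.mp h1).resolve_right (hg a ha).ne',
      (mul_eq_zero.mp h2).resolve_right (hg b hb).ne'⟩
  · refine hf.subset_of_vertices_subset (C := {x | ∃ s t : ℝ, 0 ≤ s ∧ 0 ≤ t ∧
      x = v + (s • (a - v) + t • (b - v))}) ?_ ?_
    · rintro _ ⟨s, t, hs, ht, rfl⟩ _ ⟨s', t', hs', ht', rfl⟩ c d hc hd hcd
      refine ⟨c * s + d * s', c * t + d * t', by positivity, by positivity, ?_⟩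
      have : v = (c + d) • v := by rw [hcd, one_smul]
      -- The seventh `v` is the base point on the right-hand side; written as `(c + d) • v`, it
      -- makes the identity purely linear.
      nth_rw 7 [this]
      module
    · intro x hx
      by_cases hxv : x = v
      · exact ⟨0, 0, le_rfl, le_rfl, by simp [hxv]⟩
      have hxS : x ∈ S := ⟨hx, hxv⟩
      obtain ⟨s, t, hs, ht, hst⟩ := hcomb x hxS
      have h1 := hg x hxS
      have h2 := hg a ha
      have h3 := hg b hb
      refine ⟨(g v - g x) * s * (g v - g a)⁻¹, (g v - g x) * t * (g v - g b)⁻¹,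
        by positivity, by positivity, ?_⟩
      have h4 : x = v + (g v - g x) • p x := by rw [← hxp x hxS]; abel
      nth_rw 1 [h4]
      rw [hst]
      simp only [hp]
      module

namespace PolygonCorner

variable {f : Set E3} {v a b : E3}

theorem symm (h : PolygonCorner f v a b) : PolygonCorner f v b a where
  left_mem := h.right_mem
  right_mem := h.left_mem
  indep s t hst := (h.indep t s (by rwa [add_comm])).symm
  cone x hx := by
    obtain ⟨s, t, hs, ht, rfl⟩ := h.cone x hx
    exact ⟨t, s, ht, hs, by rw [add_comm (s • _)]⟩

theorem left_ne (h : PolygonCorner f v a b) : a ≠ v := by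
  rintro rfl
  exact one_ne_zero (h.indep 1 0 (by simp)).1

theorem left_ne_right (h : PolygonCorner f v a b) : a ≠ b := by
  rintro rfl
  exact one_ne_zero (h.indep 1 (-1) (by simp)).1

/-- The coordinate along `b - v` is nonnegative on `f` and zero on the ray from `v` through `a`, so
this ray cuts out an extreme subset; it stops at `a` because `a` is an extreme point. -/
theorem segment_mem_edges (h : PolygonCorner f v a b) (hf : Convex ℝ f) (hv : v ∈ polygonVertices f) :
    segment ℝ v a ∈ polygonEdges f := by
  refine ⟨v, a, h.left_ne.symm, rfl, hf.segment_subset hv.1 h.left_mem.1, ?_⟩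
  intro x hx y hy z hz hzxy
  obtain ⟨s, t, hs, ht, hxe⟩ := h.cone x hx
  obtain ⟨s', t', hs', ht', hye⟩ := h.cone y hy
  rw [segment_eq_image'] at hz
  obtain ⟨r, -, rfl⟩ := hz
  obtain ⟨c, d, hc, hd, hcd, hz⟩ := hzxy
  have h1 : (c * s + d * s' - r) • (a - v) + (c * t + d * t') • (b - v) = 0 := by
    have h2 : c • x + d • y = (c + d) • v + ((c * s + d * s') • (a - v) +
        (c * t + d * t') • (b - v)) := by rw [hxe, hye]; module
    simp only at hz
    rw [h2, hcd, one_smul] at hz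
    have h3 := add_left_cancel hz
    rw [sub_smul, ← h3]
    module
  have h2 := (h.indep _ _ h1).2
  have h3 : t = 0 := by
    have h4 := mul_nonneg hc.le ht
    have h5 := mul_nonneg hd.le ht'
    exact (mul_eq_zero.mp (by linarith : c * t = 0)).resolve_left hc.ne'
  rw [h3, zero_smul, add_zero] at hxe
  have hs1 : s ≤ 1 := by
    by_contra! hs1
    refine h.left_ne (h.left_mem.2 hv.1 hx ⟨1 - s⁻¹, s⁻¹, ?_, by positivity, by ring, ?_⟩).symm
    · have := inv_lt_one_of_one_lt₀ hs1
      linarith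
    · have h2 : s⁻¹ * s = 1 := inv_mul_cancel₀ (by linarith)
      have h3 : (1 - s⁻¹) • v + s⁻¹ • x = v + (s⁻¹ * s) • (a - v) := by rw [hxe]; module
      rw [h3, h2]
      module
  rw [segment_eq_image']
  exact ⟨s, ⟨hs, hs1⟩, hxe.symm⟩

end PolygonCorner

/-- The endpoints of an edge are vertices. -/
theorem left_mem_vertices_of_isExtreme {f : Set E3} {x y : E3}
    (h : IsExtreme ℝ f (segment ℝ x y)) : x ∈ polygonVertices f := by
  refine h.extremePoints_subset_extremePoints ⟨left_mem_segment ℝ x y, ?_⟩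
  rintro u hu w hw ⟨p, q, hp, hq, hpq, h⟩
  rw [segment_eq_image'] at hu hw
  obtain ⟨t, ⟨ht0, -⟩, rfl⟩ := hu
  obtain ⟨r, ⟨hr0, -⟩, rfl⟩ := hw
  have h1 : (p * t + q * r) • (y - x) = 0 := by
    have h2 : p • (x + t • (y - x)) + q • (x + r • (y - x))
        = (p + q) • x + (p * t + q * r) • (y - x) := by module
    simp only at h
    rw [h2, hpq, one_smul] at h
    simpa using h
  rcases smul_eq_zero.mp h1 with h3 | h3
  · have h4 := mul_nonneg hp.le ht0
    have h5 := mul_nonneg hq.le hr0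
    have : t = 0 := (mul_eq_zero.mp (by linarith : p * t = 0)).resolve_left hp.ne'
    simp [this]
  · simp [h3]

theorem right_mem_vertices_of_isExtreme {f : Set E3} {x y : E3}
    (h : IsExtreme ℝ f (segment ℝ x y)) : y ∈ polygonVertices f :=
  left_mem_vertices_of_isExtreme (by rwa [segment_symm])

theorem eq_or_eq_of_mem_segment {f : Set E3} {x y v : E3} (h : IsExtreme ℝ f (segment ℝ x y))
    (hv : v ∈ polygonVertices f) (hvs : v ∈ segment ℝ x y) : v = x ∨ v = y := by
  by_contra! hne
  have := hv.2 (h.subset (left_mem_segment ℝ x y)) (h.subset (right_mem_segment ℝ x y))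
    (mem_openSegment_of_ne_left_right hne.1.symm hne.2.symm hvs)
  exact hne.1 this.symm

/-- An edge through a vertex ends at this vertex. -/
theorem exists_eq_segment_of_mem {f e : Set E3} {v : E3} (he : e ∈ polygonEdges f)
    (hv : v ∈ polygonVertices f) (hve : v ∈ e) :
    ∃ y, y ∈ polygonVertices f ∧ y ≠ v ∧ e = segment ℝ v y := by
  obtain ⟨x, y, hxy, rfl, h⟩ := he
  rcases eq_or_eq_of_mem_segment h hv hve with rfl | rfl
  · exact ⟨y, right_mem_vertices_of_isExtreme h, hxy.symm, rfl⟩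
  · exact ⟨x, left_mem_vertices_of_isExtreme h, hxy, segment_symm ℝ x v⟩

namespace PolygonCorner

variable {f : Set E3} {v a b : E3}

/-- A segment from `v` strictly inside the angle cannot be extreme: its points near `v` are
midpoints of points on the two sides. -/
theorem edge_eq (h : PolygonCorner f v a b) (hf : Convex ℝ f) (hv : v ∈ polygonVertices f)
    {e : Set E3} (he : e ∈ polygonEdges f) (hve : v ∈ e) :
    e = segment ℝ v a ∨ e = segment ℝ v b := by
  obtain ⟨y, hy, hyv, rfl⟩ := exists_eq_segment_of_mem he hv hve
  have hext : IsExtreme ℝ f (segment ℝ v y) := by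
    obtain ⟨_, _, _, h1, h2⟩ := he
    exact h1 ▸ h2
  obtain ⟨s, t, hs, ht, hyst⟩ := h.cone y hy.1
  have hy' : y - v = s • (a - v) + t • (b - v) := by rw [hyst]; abel
  rcases hs.eq_or_lt with rfl | hs
  · rcases ht.eq_or_lt with rfl | ht
    · simp [sub_eq_zero, hyv] at hy'
    · right
      rw [(eq_of_extremePoints_of_ray hv h.right_mem hy h.symm.left_ne ht (by simpa using hy')).2]
  rcases ht.eq_or_lt with rfl | ht
  · left
    rw [(eq_of_extremePoints_of_ray hv h.left_mem hy h.left_ne hs (by simpa using hy')).2]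
  exfalso
  -- Small enough that both `2 * (r * s)` and `2 * (r * t)` are at most `1`, so that the two points
  -- with midpoint `v + r • (y - v)` still lie on the sides.
  set r : ℝ := (2 * (1 + s + t))⁻¹ with hr
  have hr0 : 0 < r := by positivity
  have hr1 : r * (2 * (1 + s + t)) = 1 := inv_mul_cancel₀ (by positivity)
  have hrs : 0 < r * s := mul_pos hr0 hs
  have hrt : 0 < r * t := mul_pos hr0 ht
  have hmem : ∀ c ∈ polygonVertices f, ∀ q : ℝ, 0 ≤ q → q ≤ 1 → v + q • (c - v) ∈ f :=
    fun c hc q hq0 hq1 => hf.segment_subset hv.1 hc.1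
      (by rw [segment_eq_image']; exact ⟨q, ⟨hq0, hq1⟩, rfl⟩)
  have hu1 := hmem a h.left_mem (2 * (r * s)) (by linarith) (by linarith)
  have hu2 := hmem b h.right_mem (2 * (r * t)) (by linarith) (by linarith)
  have hz : v + r • (y - v) ∈ segment ℝ v y := by
    rw [segment_eq_image']
    exact ⟨r, ⟨hr0.le, by linarith⟩, rfl⟩
  have hu := hext.2 hu1 hu2 hz ⟨1 / 2, 1 / 2, by norm_num, by norm_num, by norm_num, by
    rw [hy']; module⟩
  rw [segment_eq_image'] at hu
  obtain ⟨q, -, hq⟩ := hu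
  simp only at hq
  have hq' := add_left_cancel hq
  rw [hy'] at hq'
  have h0 := h.indep (q * s - 2 * (r * s)) (q * t) (by
    rw [sub_smul, ← hq']
    module)
  have hq0 : q = 0 := (mul_eq_zero.mp h0.2).resolve_right ht.ne'
  rw [hq0] at h0
  linarith [h0.1]

end PolygonCorner

theorem PolygonCorner.right_notMem_segment {f : Set E3} {v a b : E3} (h : PolygonCorner f v a b)
    (hv : v ∈ polygonVertices f) (hf : Convex ℝ f) : b ∉ segment ℝ v a := by
  intro hb
  obtain ⟨_, _, _, h1, h2⟩ := h.segment_mem_edges hf hv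
  rcases eq_or_eq_of_mem_segment (h1 ▸ h2) h.right_mem hb with h3 | h3
  · exact h.symm.left_ne h3
  · exact h.left_ne_right h3.symm

theorem PolygonCorner.edges_inter {f : Set E3} {v a b : E3} (h : PolygonCorner f v a b)
    (hf : Convex ℝ f) (hv : v ∈ polygonVertices f) :
    {e | e ∈ polygonEdges f ∧ v ∈ e} = {segment ℝ v a, segment ℝ v b} := by
  ext e
  constructor
  · rintro ⟨he, hve⟩
    exact h.edge_eq hf hv he hve
  · rintro (rfl | rfl)
    · exact ⟨h.segment_mem_edges hf hv, left_mem_segment ℝ v a⟩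
    · exact ⟨h.symm.segment_mem_edges hf hv, left_mem_segment ℝ v b⟩

theorem PolygonCorner.segment_ne {f : Set E3} {v a b : E3} (h : PolygonCorner f v a b)
    (hf : Convex ℝ f) (hv : v ∈ polygonVertices f) : segment ℝ v a ≠ segment ℝ v b := fun heq =>
  h.right_notMem_segment hv hf (heq ▸ right_mem_segment ℝ v b)

theorem IsConvexPolygon.exists_polygonCorner_of_edge {f : Set E3} (hf : IsConvexPolygon f)
    {v a : E3} (hv : v ∈ polygonVertices f) (he : segment ℝ v a ∈ polygonEdges f) :
    ∃ b, PolygonCorner f v a b := by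
  obtain ⟨a', b', h⟩ := hf.exists_polygonCorner hv
  have key : ∀ c d, PolygonCorner f v c d → segment ℝ v a = segment ℝ v c → a = c := by
    intro c d hc heq
    have h1 : c ∈ segment ℝ v a := heq ▸ right_mem_segment ℝ v c
    obtain ⟨_, _, _, h2, h3⟩ := he
    exact ((eq_or_eq_of_mem_segment (h2 ▸ h3) hc.left_mem h1).resolve_left hc.left_ne).symm
  rcases h.edge_eq hf.convex hv he (left_mem_segment ℝ v a) with h1 | h1
  · exact ⟨b', key _ _ h h1 ▸ h⟩
  · exact ⟨a', key _ _ h.symm h1 ▸ h.symm⟩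

/-! ### Sides and middle vertices of one polygon -/

theorem IsConvexPolygon.finite_edges {f : Set E3} (hf : IsConvexPolygon f) :
    (polygonEdges f).Finite := by
  refine ((hf.finite_vertices.prod hf.finite_vertices).image
    fun p : E3 × E3 => segment ℝ p.1 p.2).subset ?_
  rintro e ⟨x, y, -, rfl, he⟩
  exact ⟨(x, y), ⟨left_mem_vertices_of_isExtreme he, right_mem_vertices_of_isExtreme he⟩, rfl⟩

/-- A convex polygon has as many sides as vertices. -/
theorem IsConvexPolygon.ncard_edges {f : Set E3} (hf : IsConvexPolygon f) :
    (polygonEdges f).ncard = (polygonVertices f).ncard := by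
  classical
  rw [Set.ncard_eq_toFinset_card _ hf.finite_edges, Set.ncard_eq_toFinset_card _ hf.finite_vertices]
  -- Count incidences: two sides at each vertex, two vertices on each side.
  have h := Finset.sum_card_bipartiteAbove_eq_sum_card_bipartiteBelow
    (s := hf.finite_vertices.toFinset) (t := hf.finite_edges.toFinset) (fun v e => v ∈ e)
  have h1 : ∀ v ∈ hf.finite_vertices.toFinset,
      (hf.finite_edges.toFinset.bipartiteAbove (fun v e => v ∈ e) v).card = 2 := by
    intro v hv
    rw [Set.Finite.mem_toFinset] at hv
    obtain ⟨a, b, hc⟩ := hf.exists_polygonCorner hv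
    rw [← Finset.card_pair (hc.segment_ne hf.convex hv)]
    congr 1
    ext e
    have := Set.ext_iff.mp (hc.edges_inter hf.convex hv) e
    simpa [Finset.mem_bipartiteAbove] using this
  have h2 : ∀ e ∈ hf.finite_edges.toFinset,
      (hf.finite_vertices.toFinset.bipartiteBelow (fun v e => v ∈ e) e).card = 2 := by
    intro e he
    rw [Set.Finite.mem_toFinset] at he
    obtain ⟨x, y, hxy, rfl, he⟩ := he
    rw [← Finset.card_pair hxy]
    congr 1
    ext v
    simp only [Finset.mem_bipartiteBelow, Set.Finite.mem_toFinset, Finset.mem_insert,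
      Finset.mem_singleton]
    constructor
    · rintro ⟨hv, hve⟩
      exact eq_or_eq_of_mem_segment he hv hve
    · rintro (rfl | rfl)
      · exact ⟨left_mem_vertices_of_isExtreme he, left_mem_segment ℝ _ _⟩
      · exact ⟨right_mem_vertices_of_isExtreme he, right_mem_segment ℝ _ _⟩
  rw [Finset.sum_congr rfl h1, Finset.sum_congr rfl h2] at h
  simpa using h.symm

/-- The vertices of `f` which are neither lowest nor highest with respect to `h`. -/
def midVertices (h : Module.Dual ℝ E3) (f : Set E3) : Set E3 :=
  {v | v ∈ polygonVertices f ∧ (∃ x ∈ polygonVertices f, h x < h v) ∧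
    ∃ y ∈ polygonVertices f, h v < h y}

/-- Heights are distinct and there are at least two vertices, so exactly one highest and one lowest
vertex are removed, and they differ. -/
theorem IsConvexPolygon.ncard_midVertices {f : Set E3} (hf : IsConvexPolygon f)
    {h : Module.Dual ℝ E3} (hinj : Set.InjOn h (polygonVertices f)) :
    (midVertices h f).ncard + 2 = (polygonVertices f).ncard := by
  have hfin := hf.finite_vertices
  -- Used only to produce some vertex.
  obtain ⟨v, hv, -⟩ := hf.exists_vertex_not_mem_span 0 0
  obtain ⟨a, b, hc⟩ := hf.exists_polygonCorner hv
  obtain ⟨x, hx, hxmax⟩ := Set.exists_max_image _ h hfin ⟨v, hv⟩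
  obtain ⟨y, hy, hymin⟩ := Set.exists_min_image _ h hfin ⟨v, hv⟩
  have hyx : h y ≠ h x := fun heq => hc.left_ne_right (hinj hc.left_mem hc.right_mem (by
    have := hxmax a hc.left_mem
    have := hymin a hc.left_mem
    have := hxmax b hc.right_mem
    have := hymin b hc.right_mem
    linarith))
  have hlt : h y < h x := lt_of_le_of_ne (hymin x hx) hyx
  have heq : polygonVertices f = insert x (insert y (midVertices h f)) := by
    ext w
    constructor
    · intro hw
      by_cases hwx : w = x
      · exact Or.inl hwx
      by_cases hwy : w = y
      · exact Or.inr (Or.inl hwy)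
      exact Or.inr (Or.inr ⟨hw,
        ⟨y, hy, lt_of_le_of_ne (hymin w hw) fun h1 => hwy (hinj hw hy h1.symm)⟩,
        ⟨x, hx, lt_of_le_of_ne (hxmax w hw) fun h1 => hwx (hinj hw hx h1)⟩⟩)
    · rintro (rfl | rfl | hw)
      exacts [hx, hy, hw.1]
  have hmf : (midVertices h f).Finite := hfin.subset fun w hw => hw.1
  have hym : y ∉ midVertices h f := by
    rintro ⟨-, ⟨z, hz, hzy⟩, -⟩
    exact absurd (hymin z hz) (not_le.mpr hzy)
  have hxm : x ∉ insert y (midVertices h f) := by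
    rintro (rfl | ⟨-, -, z, hz, hzy⟩)
    · exact hyx rfl
    · exact absurd (hxmax z hz) (not_le.mpr hzy)
  rw [heq, Set.ncard_insert_of_notMem hxm (hmf.insert y), Set.ncard_insert_of_notMem hym hmf]

/-- The number of sides descending from `v` is odd exactly if `v` is neither lowest nor highest. -/
theorem IsConvexPolygon.even_ncard_descending {f : Set E3} (hf : IsConvexPolygon f)
    {h : Module.Dual ℝ E3} (hinj : Set.InjOn h (polygonVertices f)) {v : E3}
    (hv : v ∈ polygonVertices f) :
    (v ∈ midVertices h f → {e | e ∈ polygonEdges f ∧ v ∈ e ∧ ∃ y ∈ e, h y < h v}.ncard = 1) ∧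
    (v ∉ midVertices h f →
      Even {e | e ∈ polygonEdges f ∧ v ∈ e ∧ ∃ y ∈ e, h y < h v}.ncard) := by
  obtain ⟨a, b, hc⟩ := hf.exists_polygonCorner hv
  have hseg : ∀ c, (∃ y ∈ segment ℝ v c, h y < h v) ↔ h c < h v := by
    intro c
    constructor
    · rintro ⟨y, hy, hlt⟩
      rw [segment_eq_image'] at hy
      obtain ⟨t, ⟨ht, -⟩, rfl⟩ := hy
      simp only [map_add, map_smul, map_sub, smul_eq_mul] at hlt
      by_contra! hle
      have := mul_nonneg ht (sub_nonneg.mpr hle)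
      linarith
    · exact fun hlt => ⟨c, right_mem_segment ℝ v c, hlt⟩
  have hset : {e | e ∈ polygonEdges f ∧ v ∈ e ∧ ∃ y ∈ e, h y < h v} =
      {e | (e = segment ℝ v a ∧ h a < h v) ∨ (e = segment ℝ v b ∧ h b < h v)} := by
    ext e
    have h1 := Set.ext_iff.mp (hc.edges_inter hf.convex hv) e
    constructor
    · rintro ⟨h2, h3, h4⟩
      rcases h1.mp ⟨h2, h3⟩ with rfl | rfl
      · exact Or.inl ⟨rfl, (hseg _).mp h4⟩
      · exact Or.inr ⟨rfl, (hseg _).mp h4⟩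
    · rintro (⟨rfl, h4⟩ | ⟨rfl, h4⟩)
      · have := h1.mpr (Or.inl rfl)
        exact ⟨this.1, this.2, (hseg _).mpr h4⟩
      · have := h1.mpr (Or.inr rfl)
        exact ⟨this.1, this.2, (hseg _).mpr h4⟩
  have hcone : ∀ x ∈ polygonVertices f, ∃ s t : ℝ, 0 ≤ s ∧ 0 ≤ t ∧
      h x = h v + (s * (h a - h v) + t * (h b - h v)) := by
    intro x hx
    obtain ⟨s, t, hs, ht, rfl⟩ := hc.cone x hx.1
    exact ⟨s, t, hs, ht, by simp⟩
  have hav : h a ≠ h v := fun heq => hc.left_ne (hinj hc.left_mem hv heq)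
  have hbv : h b ≠ h v := fun heq => hc.symm.left_ne (hinj hc.right_mem hv heq)
  rw [hset]
  -- If both sides at `v` descend, the cone condition keeps the whole polygon at or below `v`; if
  -- both ascend, at or above. Otherwise `v` is a middle vertex with exactly one descending side.
  rcases lt_or_gt_of_ne hav with ha | ha <;> rcases lt_or_gt_of_ne hbv with hb | hb
  · refine ⟨?_, fun _ => ?_⟩
    · rintro ⟨-, -, y, hy, hlt⟩
      obtain ⟨s, t, hs, ht, heq⟩ := hcone y hy
      nlinarith
    · have : {e | (e = segment ℝ v a ∧ h a < h v) ∨ (e = segment ℝ v b ∧ h b < h v)} =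
          {segment ℝ v a, segment ℝ v b} := by
        ext e
        simp [ha, hb]
      rw [this, Set.ncard_pair (hc.segment_ne hf.convex hv)]
      exact even_two
  · refine ⟨fun _ => ?_, fun hm => absurd ⟨hv, ⟨a, hc.left_mem, ha⟩, b, hc.right_mem, hb⟩ hm⟩
    have : {e | (e = segment ℝ v a ∧ h a < h v) ∨ (e = segment ℝ v b ∧ h b < h v)} =
        {segment ℝ v a} := by
      ext e
      simp [ha, hb.not_gt]
    rw [this, Set.ncard_singleton]
  · refine ⟨fun _ => ?_, fun hm => absurd ⟨hv, ⟨b, hc.right_mem, hb⟩, a, hc.left_mem, ha⟩ hm⟩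
    have : {e | (e = segment ℝ v a ∧ h a < h v) ∨ (e = segment ℝ v b ∧ h b < h v)} =
        {segment ℝ v b} := by
      ext e
      simp [hb, ha.not_gt]
    rw [this, Set.ncard_singleton]
  · refine ⟨?_, fun _ => ?_⟩
    · rintro ⟨-, ⟨y, hy, hlt⟩, -⟩
      obtain ⟨s, t, hs, ht, heq⟩ := hcone y hy
      nlinarith
    · have : {e | (e = segment ℝ v a ∧ h a < h v) ∨ (e = segment ℝ v b ∧ h b < h v)} = ∅ := by
        ext e
        simp [ha.not_gt, hb.not_gt]
      rw [this]
      simp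

/-! ### How faces meet, and parity of the number of middle faces -/

namespace Polyhedron

variable (P : Polyhedron)

variable {P} in
theorem polygonVertices_subset {f : Set E3} (hf : f ∈ P.faces) : polygonVertices f ⊆ P.vertices :=
  fun _ hv => Set.mem_biUnion (by exact hf) hv

variable {P} in
theorem polygonEdges_subset {f : Set E3} (hf : f ∈ P.faces) : polygonEdges f ⊆ P.edges :=
  fun _ hv => Set.mem_biUnion (by exact hf) hv

-- The intersection rule excludes a vertex of one face in the interior of another face or of its
-- side: a common point is a common vertex, or it lies on a common edge and, being extreme, is an
-- endpoint.
variable {P} in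
theorem mem_polygonVertices {v : E3} (hv : v ∈ P.vertices) {f : Set E3} (hf : f ∈ P.faces)
    (hvf : v ∈ f) : v ∈ polygonVertices f := by
  obtain ⟨g, hg, hvg⟩ := Set.mem_iUnion₂.mp hv
  by_cases hfg : f = g
  · exact hfg ▸ hvg
  have hmem : v ∈ f ∩ g := ⟨hvf, hvg.1⟩
  rcases P.inter_of_ne f hf g hg hfg with h | ⟨w, hw, h⟩ | ⟨h1, h2⟩
  · rw [h] at hmem
    exact hmem.elim
  · rw [h] at hmem
    rw [Set.mem_singleton_iff.mp hmem]
    exact hw.1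
  · obtain ⟨y, -, -, heq⟩ := exists_eq_segment_of_mem h2 hvg hmem
    obtain ⟨_, _, _, -, h4⟩ := h1
    rw [heq] at h4
    exact left_mem_vertices_of_isExtreme h4

/-- Two distinct faces with a common vertex and a further common point share an edge at this
vertex. -/
theorem inter_mem_edges {f g : Set E3} (hf : f ∈ P.faces) (hg : g ∈ P.faces) (hfg : f ≠ g)
    {v z : E3} (hvf : v ∈ f) (hvg : v ∈ g) (hzf : z ∈ f) (hzg : z ∈ g) (hzv : z ≠ v) :
    f ∩ g ∈ polygonEdges f ∩ polygonEdges g := by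
  rcases P.inter_of_ne f hf g hg hfg with h | ⟨w, -, h⟩ | h
  · exact absurd ⟨hvf, hvg⟩ (h ▸ Set.notMem_empty v : v ∉ f ∩ g)
  · have h1 : v ∈ f ∩ g := ⟨hvf, hvg⟩
    have h2 : z ∈ f ∩ g := ⟨hzf, hzg⟩
    rw [h] at h1 h2
    exact absurd (h2.trans h1.symm) hzv
  · exact h

/-- Count pairs of a face and an edge of it descending from `v`. Each edge lies on two faces, so the
total is even; a face contributes an odd number exactly when `v` is a middle vertex of it. -/
theorem even_ncard_midVertices {h : Module.Dual ℝ E3} (hinj : Set.InjOn h P.vertices) {v : E3}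
    (hv : v ∈ P.vertices) : Even {f | f ∈ P.faces ∧ v ∈ midVertices h f}.ncard := by
  classical
  set D := P.finite_edges.toFinset.filter fun e => v ∈ e ∧ ∃ y ∈ e, h y < h v with hD
  have hcount := Finset.sum_card_bipartiteAbove_eq_sum_card_bipartiteBelow
    (s := P.faces) (t := D) (fun f e => e ∈ polygonEdges f)
  have h1 : ∀ e ∈ D, (P.faces.bipartiteBelow (fun f e => e ∈ polygonEdges f) e).card = 2 := by
    intro e he
    rw [hD, Finset.mem_filter, Set.Finite.mem_toFinset] at he
    rw [← P.two_faces_of_edge e he.1, ← Set.ncard_coe_finset]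
    congr 1
    ext f
    simp
  rw [Finset.sum_congr rfl h1, Finset.sum_const, smul_eq_mul] at hcount
  have h2 : ∀ f ∈ P.faces, (D.bipartiteAbove (fun f e => e ∈ polygonEdges f) f).card =
      {e | e ∈ polygonEdges f ∧ v ∈ e ∧ ∃ y ∈ e, h y < h v}.ncard := by
    intro f hf
    rw [← Set.ncard_coe_finset]
    congr 1
    ext e
    simp only [Finset.mem_coe, Finset.mem_bipartiteAbove, hD, Finset.mem_filter,
      Set.Finite.mem_toFinset, Set.mem_ofPred_eq]
    exact ⟨fun h => ⟨h.2, h.1.2⟩, fun h => ⟨⟨polygonEdges_subset hf h.1, h.2⟩, h.1⟩⟩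
  have h3 : {f | f ∈ P.faces ∧ v ∈ midVertices h f}.ncard =
      ∑ f ∈ P.faces, if v ∈ midVertices h f then 1 else 0 := by
    rw [← Finset.card_filter, ← Set.ncard_coe_finset]
    congr 1
    ext f
    simp
  have h4 : Even (∑ f ∈ P.faces, ((D.bipartiteAbove (fun f e => e ∈ polygonEdges f) f).card +
      if v ∈ midVertices h f then 1 else 0)) := by
    refine Finset.even_sum _ fun f hf => ?_
    rw [h2 f hf]
    have hpoly := P.isConvexPolygon_of_mem f hf
    by_cases hvf : v ∈ polygonVertices f
    · obtain ⟨h5, h6⟩ := hpoly.even_ncard_descending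
        (hinj.mono (polygonVertices_subset hf)) hvf
      by_cases hm : v ∈ midVertices h f
      · rw [h5 hm, if_pos hm]
        exact even_two
      · rw [if_neg hm]
        exact h6 hm
    · have h5 : {e | e ∈ polygonEdges f ∧ v ∈ e ∧ ∃ y ∈ e, h y < h v} = ∅ := by
        ext e
        simp only [Set.mem_ofPred_eq, Set.mem_empty_iff_false, iff_false]
        rintro ⟨⟨x, y, -, rfl, he⟩, hve, -⟩
        exact hvf (mem_polygonVertices hv hf (he.subset hve))
      rw [h5, if_neg fun hm => hvf hm.1]
      simp
  rw [Finset.sum_add_distrib, hcount, ← h3] at h4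
  exact (Nat.even_add.mp h4).mp (by simp)

/-! ### At most two middle faces: the horizontal slice through a vertex -/

/-- The point where the horizontal plane through `v` leaves the face `f`. -/
theorem exists_horizontal {f : Set E3} (hf : IsConvexPolygon f) {h : Module.Dual ℝ E3} {v : E3}
    (hv : v ∈ midVertices h f) : ∃ d : E3, d ≠ 0 ∧ h d = 0 ∧ v + d ∈ f := by
  obtain ⟨hv, ⟨x, hx, hxv⟩, y, hy, hyv⟩ := hv
  -- The weights for which `s • x + t • y` has the height of `v`.
  set s := (h y - h v) / (h y - h x) with hs
  set t := (h v - h x) / (h y - h x) with ht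
  have hpos : 0 < h y - h x := by linarith
  have hs0 : 0 < s := div_pos (by linarith) hpos
  have ht0 : 0 < t := div_pos (by linarith) hpos
  have hst : s + t = 1 := by rw [hs, ht]; field_simp; ring
  have hval : s * h x + t * h y = h v := by rw [hs, ht]; field_simp; ring
  refine ⟨s • x + t • y - v, fun h0 => ?_, ?_, ?_⟩
  · have := hv.2 hx.1 hy.1 ⟨s, t, hs0, ht0, hst, sub_eq_zero.mp h0⟩
    rw [this] at hxv
    exact lt_irrefl _ hxv
  · simp [hval]
  · rw [add_sub_cancel]
    exact hf.convex hx.1 hy.1 hs0.le ht0.le hst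

/-- Two faces leaving `v` along the same horizontal ray share a point other than `v`, hence an edge
at `v`. That edge would be horizontal, with two endpoints of equal height. -/
theorem not_parallel_horizontal {h : Module.Dual ℝ E3} (hinj : Set.InjOn h P.vertices)
    {f g : Set E3} (hf : f ∈ P.faces) (hg : g ∈ P.faces) (hfg : f ≠ g) {v : E3}
    (hvf : v ∈ polygonVertices f) (hvg : v ∈ polygonVertices g) {d : E3} (hd : d ≠ 0)
    (hd0 : h d = 0) {c : ℝ} (hc : 0 < c) (hdf : v + d ∈ f) (hdg : v + c • d ∈ g) : False := by
  have hmem : ∀ k ∈ P.faces, ∀ w : E3, v ∈ k → v + w ∈ k → ∀ r : ℝ, 0 ≤ r → r ≤ 1 → v + r • w ∈ k :=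
    fun k hk w hvk hwk r hr0 hr1 =>
      (P.isConvexPolygon_of_mem k hk).convex.segment_subset hvk hwk
        (by rw [segment_eq_image']; exact ⟨r, ⟨hr0, hr1⟩, by simp⟩)
  -- The factor is at most `1`, and it is `c` times `1 / (1 + c)`, which is also at most `1`; so
  -- convexity puts the point in both faces.
  have hz : v + (c / (1 + c)) • d ∈ f := hmem f hf d hvf.1 hdf _ (by positivity)
    ((div_le_one (by positivity)).mpr (by linarith))
  have hz' : v + (c / (1 + c)) • d ∈ g := by
    have := hmem g hg (c • d) hvg.1 hdg (1 / (1 + c)) (by positivity)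
      ((div_le_one (by positivity)).mpr (by linarith))
    rwa [smul_smul, one_div_mul_eq_div] at this
  have hr : c / (1 + c) ≠ 0 := by positivity
  have hne : v + (c / (1 + c)) • d ≠ v := by simp [hd, hr]
  obtain ⟨he, -⟩ := P.inter_mem_edges hf hg hfg hvf.1 hvg.1 hz hz' hne
  obtain ⟨y, hy, hyv, heq⟩ := exists_eq_segment_of_mem he hvf ⟨hvf.1, hvg.1⟩
  have hzs : v + (c / (1 + c)) • d ∈ segment ℝ v y := heq ▸ ⟨hz, hz'⟩
  rw [segment_eq_image'] at hzs
  obtain ⟨q, -, hq⟩ := hzs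
  have hq' := add_left_cancel hq
  have h1 := congrArg h hq'
  simp only [map_smul, map_sub, smul_eq_mul, hd0, mul_zero] at h1
  rcases mul_eq_zero.mp h1 with h2 | h2
  · rw [h2, zero_smul] at hq'
    exact hd ((smul_eq_zero.mp hq'.symm).resolve_left hr)
  · exact hyv (hinj (polygonVertices_subset hf hy) (polygonVertices_subset hf hvf)
      (sub_eq_zero.mp h2))

end Polyhedron

/-- A functional vanishing on three linearly independent vectors is zero. -/
theorem eq_zero_of_linearIndependent {l : E3 →L[ℝ] ℝ} {x y z : E3}
    (hind : LinearIndependent ℝ ![x, y, z]) (hx : l x = 0) (hy : l y = 0) (hz : l z = 0) :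
    l = 0 := by
  have hspan := hind.span_eq_top_of_card_eq_finrank (by simp)
  ext w
  have hw : w ∈ Submodule.span ℝ (Set.range ![x, y, z]) := hspan ▸ Submodule.mem_top
  have hle : Submodule.span ℝ (Set.range ![x, y, z]) ≤ l.toLinearMap.ker := by
    rw [Submodule.span_le]
    rintro _ ⟨i, rfl⟩
    fin_cases i <;> simp [hx, hy, hz]
  exact hle hw

theorem exists_combination_of_linearIndependent {x y z : E3}
    (hind : LinearIndependent ℝ ![x, y, z]) (w : E3) :
    ∃ a b c : ℝ, w = a • x + b • y + c • z := by
  have hspan := hind.span_eq_top_of_card_eq_finrank (by simp)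
  have hw : w ∈ Submodule.span ℝ (Set.range ![x, y, z]) := hspan ▸ Submodule.mem_top
  obtain ⟨c, hc⟩ := (Submodule.mem_span_range_iff_exists_fun ℝ).mp hw
  exact ⟨c 0, c 1, c 2, by rw [← hc, Fin.sum_univ_three]; simp⟩

theorem linearIndependent_triple {x y z : E3}
    (h : ∀ a b c : ℝ, a • x + b • y + c • z = 0 → a = 0 ∧ b = 0 ∧ c = 0) :
    LinearIndependent ℝ ![x, y, z] := by
  rw [Fintype.linearIndependent_iff]
  intro g hg
  rw [Fin.sum_univ_three] at hg
  obtain ⟨h0, h1, h2⟩ := h (g 0) (g 1) (g 2) (by simpa using hg)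
  intro i
  fin_cases i
  exacts [h0, h1, h2]

/-- Among three directions in a plane, each on a line supporting the others, two coincide. -/
theorem exists_pos_smul_of_three_supporting {h : Module.Dual ℝ E3} {u : E3} (hu : h u ≠ 0)
    (d : Fin 3 → E3) (l : Fin 3 → E3 →L[ℝ] ℝ) (hd : ∀ i, d i ≠ 0) (hhd : ∀ i, h (d i) = 0)
    (hl : ∀ i, l i (d i) = 0) (hle : ∀ i j, l i (d j) ≤ 0)
    (hne : ∀ i, ∀ x y : E3, h x = 0 → h y = 0 → l i x = 0 → l i y = 0 →
      ∃ s t : ℝ, s • x + t • y = 0 ∧ ¬(s = 0 ∧ t = 0)) :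
    ∃ i j, i ≠ j ∧ ∃ c : ℝ, 0 < c ∧ d j = c • d i := by
  -- By `hne`, each `l i` vanishes on at most a line of the plane `h = 0`. Hence a common zero of `l
  -- i` with `d i` is a multiple of `d i`.
  have hdep : ∀ i j, (∃ s t : ℝ, s • d i + t • d j = 0 ∧ ¬(s = 0 ∧ t = 0)) →
      ∃ c : ℝ, c ≠ 0 ∧ d j = c • d i := by
    rintro i j ⟨s, t, hst, hn⟩
    have ht : t ≠ 0 := by
      rintro rfl
      rw [zero_smul, add_zero] at hst
      exact hn ⟨(smul_eq_zero.mp hst).resolve_right (hd i), rfl⟩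
    have hs : s ≠ 0 := by
      rintro rfl
      rw [zero_smul, zero_add] at hst
      exact hn ⟨rfl, (smul_eq_zero.mp hst).resolve_right (hd j)⟩
    refine ⟨-(t⁻¹ * s), by simp [hs, ht], ?_⟩
    have h1 : t • d j = -(s • d i) := by rw [← add_eq_zero_iff_neg_eq.mp hst]
    have h2 : d j = t⁻¹ • (t • d j) := by rw [smul_smul, inv_mul_cancel₀ ht, one_smul]
    rw [h2, h1]
    module
  by_cases h01 : ∃ s t : ℝ, s • d 0 + t • d 1 = 0 ∧ ¬(s = 0 ∧ t = 0)
  · obtain ⟨c, hc, hc1⟩ := hdep 0 1 h01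
    rcases lt_or_gt_of_ne hc with hc | hc
    swap
    · exact ⟨0, 1, by decide, c, hc, hc1⟩
    by_cases h02 : ∃ s t : ℝ, s • d 0 + t • d 2 = 0 ∧ ¬(s = 0 ∧ t = 0)
    · obtain ⟨c', hc', hc2⟩ := hdep 0 2 h02
      rcases lt_or_gt_of_ne hc' with hc' | hc'
      · refine ⟨1, 2, by decide, c' / c, div_pos_of_neg_of_neg hc' hc, ?_⟩
        rw [hc1, hc2, smul_smul, div_mul_cancel₀ _ hc.ne]
      · exact ⟨0, 2, by decide, c', hc', hc2⟩
    -- Here `d 0` and `d 1` are opposite, so `l 2` being nonpositive on both vanishes on both, which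
    -- makes `d 2` parallel to them.
    · exfalso
      have h1 := hle 2 0
      have h2 := hle 2 1
      rw [hc1, map_smul, smul_eq_mul] at h2
      have h3 : l 2 (d 0) = 0 := by nlinarith
      exact h02 (hne 2 _ _ (hhd 0) (hhd 2) h3 (hl 2))
  -- Now `d 0` and `d 1` are a basis of the plane; `u` only completes it to a basis of space. The
  -- supporting lines of `d 0` and `d 1` force `d 2` into the angle between them, and its own
  -- supporting line forbids the interior of that angle.
  · have hind : LinearIndependent ℝ ![d 0, d 1, u] := by
      refine linearIndependent_triple fun a b c habc => ?_
      have h1 := congrArg h habc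
      simp only [map_add, map_smul, hhd, smul_eq_mul, mul_zero, zero_add, map_zero] at h1
      have hc : c = 0 := (mul_eq_zero.mp h1).resolve_right hu
      subst hc
      rw [zero_smul, add_zero] at habc
      by_contra hn
      exact h01 ⟨a, b, habc, fun h2 => hn ⟨h2.1, h2.2, rfl⟩⟩
    obtain ⟨a, b, c, habc⟩ := exists_combination_of_linearIndependent hind (d 2)
    have hc : c = 0 := by
      have h1 := congrArg h habc
      simp only [map_add, map_smul, hhd, smul_eq_mul, mul_zero, zero_add] at h1
      exact (mul_eq_zero.mp h1.symm).resolve_right hu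
    subst hc
    rw [zero_smul, add_zero] at habc
    have l01 : l 0 (d 1) < 0 := lt_of_le_of_ne (hle 0 1) fun h1 =>
      h01 (hne 0 _ _ (hhd 0) (hhd 1) (hl 0) h1)
    have l10 : l 1 (d 0) < 0 := lt_of_le_of_ne (hle 1 0) fun h1 =>
      h01 (hne 1 _ _ (hhd 0) (hhd 1) h1 (hl 1))
    have hb : 0 ≤ b := by
      have h1 := hle 0 2
      rw [habc, map_add, map_smul, map_smul, hl 0, smul_eq_mul, smul_eq_mul] at h1
      nlinarith
    have ha : 0 ≤ a := by
      have h1 := hle 1 2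
      rw [habc, map_add, map_smul, map_smul, hl 1, smul_eq_mul, smul_eq_mul] at h1
      nlinarith
    rcases ha.eq_or_lt with rfl | ha
    · rw [zero_smul, zero_add] at habc
      refine ⟨1, 2, by decide, b, hb.lt_of_ne ?_, habc⟩
      rintro rfl
      exact hd 2 (by simpa using habc)
    rcases hb.eq_or_lt with rfl | hb
    · exact ⟨0, 2, by decide, a, ha, by simpa using habc⟩
    exfalso
    have h1 := hl 2
    rw [habc, map_add, map_smul, map_smul, smul_eq_mul, smul_eq_mul] at h1
    have h2 := hle 2 0
    have h3 := hle 2 1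
    have h4 : l 2 (d 0) = 0 := by nlinarith
    have h5 : l 2 (d 1) = 0 := by nlinarith
    exact h01 (hne 2 _ _ (hhd 0) (hhd 1) h4 h5)

namespace Polyhedron

variable {P : Polyhedron}

theorem subset_surface {f : Set E3} (hf : f ∈ P.faces) : f ⊆ P.surface :=
  fun _ hv => Set.mem_biUnion (by exact hf) hv

theorem vertices_subset_surface : P.vertices ⊆ P.surface := by
  intro v hv
  obtain ⟨f, hf, hvf⟩ := Set.mem_iUnion₂.mp hv
  exact subset_surface hf hvf.1

theorem IsConvex.exists_supporting (hP : P.IsConvex) {f : Set E3} (hf : f ∈ P.faces) {v : E3}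
    (hv : v ∈ f) : ∃ l : E3 →L[ℝ] ℝ, l ≠ 0 ∧ (∀ x ∈ f, l (x - v) = 0) ∧
      ∀ x ∈ P.surface, l (x - v) ≤ 0 := by
  obtain ⟨l, c, hl, h1, h2⟩ := hP f hf
  refine ⟨l, hl, fun x hx => ?_, fun x hx => ?_⟩
  · rw [map_sub, h1 x hx, h1 v hv, sub_self]
  · rw [map_sub, h1 v hv]
    linarith [h2 x hx]

/-- In the plane `h = h v` the planes of the faces cut out lines that support the slice. Of three
middle faces, two would leave `v` along the same ray. -/
theorem IsConvex.ncard_midVertices_le_two (hP : P.IsConvex) {h : Module.Dual ℝ E3}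
    (hinj : Set.InjOn h P.vertices) (v : E3) :
    {f | f ∈ P.faces ∧ v ∈ midVertices h f}.ncard ≤ 2 := by
  by_contra! hlt
  have hfin : {f | f ∈ P.faces ∧ v ∈ midVertices h f}.Finite :=
    P.faces.finite_toSet.subset fun f hf => hf.1
  obtain ⟨f₀, f₁, f₂, h₀, h₁, h₂, h01, h02, h12⟩ := (Set.two_lt_ncard_iff hfin).mp hlt
  set F : Fin 3 → Set E3 := ![f₀, f₁, f₂] with hF
  have hmem : ∀ i, F i ∈ P.faces ∧ v ∈ midVertices h (F i) := by
    intro i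
    fin_cases i
    exacts [h₀, h₁, h₂]
  have hFinj : ∀ i j, i ≠ j → F i ≠ F j := by
    intro i j hij
    fin_cases i <;> fin_cases j <;> first | exact absurd rfl hij | skip
    exacts [h01, h02, h01.symm, h12, h02.symm, h12.symm]
  choose d hd hhd hdF using fun i =>
    exists_horizontal (P.isConvexPolygon_of_mem _ (hmem i).1) (hmem i).2
  choose l hl hl0 hlle using fun i => hP.exists_supporting (hmem i).1 (hmem i).2.1.1
  obtain ⟨-, -, y, hy, hvy⟩ := (hmem 0).2
  obtain ⟨i, j, hij, c, hc, hcd⟩ := exists_pos_smul_of_three_supporting (h := h) (u := y - v)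
    (by rw [map_sub]; exact (sub_pos.mpr hvy).ne') d l hd hhd
    (fun i => by simpa using hl0 i _ (hdF i))
    (fun i j => by simpa using hlle i _ (subset_surface (hmem j).1 (hdF j)))
    -- The plane of a middle face is not horizontal, as it contains a vertex `w` above `v`; a
    -- functional vanishing on two independent horizontal vectors and on `w - v` would be zero.
    (by
      intro i x z hx hz hlx hlz
      by_contra! hn
      obtain ⟨-, -, w, hw, hvw⟩ := (hmem i).2
      refine hl i (eq_zero_of_linearIndependent (x := x) (y := z) (z := w - v) ?_ hlx hlz
        (hl0 i w hw.1))
      refine linearIndependent_triple fun a b c habc => ?_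
      have h1 := congrArg h habc
      simp only [map_add, map_smul, hx, hz, map_sub, smul_eq_mul, mul_zero, zero_add,
        map_zero] at h1
      have hc : c = 0 := (mul_eq_zero.mp h1).resolve_right (sub_pos.mpr hvw).ne'
      subst hc
      rw [zero_smul, add_zero] at habc
      exact ⟨(hn a b habc).1, (hn a b habc).2, rfl⟩)
  exact P.not_parallel_horizontal hinj (hmem i).1 (hmem j).1 (hFinj i j hij) (hmem i).2.1
    (hmem j).2.1 (hd i) (hhd i) hc (hdF i) (hcd ▸ hdF j)

/-! ### At least one middle face: descending faces close up below a vertex -/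

theorem exists_other_face {f e : Set E3} (hf : f ∈ P.faces) (he : e ∈ polygonEdges f) :
    ∃ g ∈ P.faces, f ≠ g ∧ e ∈ polygonEdges g := by
  have h := P.two_faces_of_edge e (polygonEdges_subset hf he)
  obtain ⟨x, y, hxy, heq⟩ := Set.ncard_eq_two.mp h
  have hx : x ∈ ({x, y} : Set (Set E3)) := Or.inl rfl
  have hy : y ∈ ({x, y} : Set (Set E3)) := Or.inr rfl
  rw [← heq] at hx hy
  by_cases hfx : f = x
  · exact ⟨y, hy.1, hfx ▸ hxy, hy.2⟩
  · exact ⟨x, hx.1, hfx, hx.2⟩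

theorem eventually_mem_of_corner {f : Set E3} (hf : Convex ℝ f) {v a b : E3} (hv : v ∈ f)
    (ha : a ∈ f) (hb : b ∈ f) {s t : ℝ} (hs : 0 ≤ s) (ht : 0 ≤ t) {ε : ℝ} (hε : 0 ≤ ε)
    (hle : ε * (s + t) ≤ 1) : v + ε • (s • (a - v) + t • (b - v)) ∈ f := by
  have h1 : v + ε • (s • (a - v) + t • (b - v)) =
      (1 - ε * (s + t)) • v + (ε * s) • a + (ε * t) • b := by module
  rw [h1]
  have h2 := hf.sum_mem (t := Finset.univ) (w := ![1 - ε * (s + t), ε * s, ε * t])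
    (z := ![v, a, b]) (by
      intro i _
      fin_cases i
      · simpa using hle
      · simpa using mul_nonneg hε hs
      · simpa using mul_nonneg hε ht) (by
      simp only [Fin.sum_univ_three, Matrix.cons_val]
      ring) (by
      intro i _
      fin_cases i
      exacts [hv, ha, hb])
  simpa [Fin.sum_univ_three] using h2

/-- Two faces sharing an edge do not overlap near it. -/
theorem not_overlap_at_edge {f g : Set E3} (hf : f ∈ P.faces) (hg : g ∈ P.faces) (hfg : f ≠ g)
    {v a b c : E3} (hvf : v ∈ polygonVertices f) (hvg : v ∈ polygonVertices g)
    (hcf : PolygonCorner f v a b) (hcg : PolygonCorner g v a c) {s t s' t' : ℝ} (hs : 0 ≤ s)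
    (ht : 0 < t) (hs' : 0 ≤ s') (ht' : 0 ≤ t')
    (heq : s • (a - v) + t • (b - v) = s' • (a - v) + t' • (c - v)) : False := by
  have hcvf := (P.isConvexPolygon_of_mem f hf).convex
  have hcvg := (P.isConvexPolygon_of_mem g hg).convex
  have hpos : 0 < 1 + (s + t) + (s' + t') := by positivity
  -- Scales the common direction so that the point lies in both faces; it must then lie on their
  -- common edge, contradicting `0 < t`.
  set ε := (1 + (s + t) + (s' + t'))⁻¹ with hε
  have hε0 : 0 < ε := by positivity
  have hε1 : ε * (1 + (s + t) + (s' + t')) = 1 := inv_mul_cancel₀ hpos.ne'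
  have h1 : 0 ≤ ε * (s + t) := by positivity
  have h2 : 0 ≤ ε * (s' + t') := by positivity
  have hzf := eventually_mem_of_corner hcvf hvf.1 hcf.left_mem.1 hcf.right_mem.1 hs ht.le hε0.le
    (by linarith)
  have hzg := eventually_mem_of_corner hcvg hvg.1 hcg.left_mem.1 hcg.right_mem.1 hs' ht' hε0.le
    (by linarith)
  rw [← heq] at hzg
  obtain ⟨he, -⟩ := P.inter_mem_edges hf hg hfg hvf.1 hvg.1 hcf.left_mem.1 hcg.left_mem.1
    hcf.left_ne
  have hi : f ∩ g = segment ℝ v a := by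
    refine (hcf.edge_eq hcvf hvf he ⟨hvf.1, hvg.1⟩).resolve_right fun h3 => ?_
    refine hcf.symm.right_notMem_segment hvf hcvf ?_
    rw [← h3]
    exact ⟨hcf.left_mem.1, hcg.left_mem.1⟩
  have hz : v + ε • (s • (a - v) + t • (b - v)) ∈ segment ℝ v a := hi ▸ ⟨hzf, hzg⟩
  rw [segment_eq_image'] at hz
  obtain ⟨q, -, hq⟩ := hz
  have hq' := add_left_cancel hq
  have := (hcf.indep (ε * s - q) (ε * t) (by rw [sub_smul, hq']; module)).2
  exact (mul_pos hε0 ht).ne' this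

end Polyhedron

namespace Polyhedron

variable {P : Polyhedron}

/-- A vertex with a descending edge all of whose faces have it as an end is a highest point. -/
theorem IsConvex.le_of_forall_notMem_midVertices (hP : P.IsConvex) {h : Module.Dual ℝ E3}
    (hinj : Set.InjOn h P.vertices) {v : E3} (hmid : ∀ f ∈ P.faces, v ∉ midVertices h f)
    {f₀ : Set E3} (hf₀ : f₀ ∈ P.faces) (hv₀ : v ∈ polygonVertices f₀) {x₀ : E3}
    (hx₀ : x₀ ∈ polygonVertices f₀) (hlt₀ : h x₀ < h v) {y : E3} (hy : y ∈ P.vertices) :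
    h y ≤ h v := by
  by_contra! hvy
  have hlow : ∀ f ∈ P.faces, v ∈ polygonVertices f → ∀ x ∈ polygonVertices f, h x < h v →
      ∀ z ∈ polygonVertices f, z ≠ v → h z < h v := by
    intro f hf hvf x hx hxv z hz hzv
    refine lt_of_le_of_ne (not_lt.mp fun h1 => hmid f hf ⟨hvf, ⟨x, hx, hxv⟩, z, hz, h1⟩) fun h1 =>
      hzv (hinj (polygonVertices_subset hf hz) (polygonVertices_subset hf hvf) h1)
  -- The neighbours of `v` below it. Since `v` is a middle vertex of no face, a face with one such
  -- side at `v` has both; `p` below places these directions in the slice one unit lower.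
  set T : Set E3 := {a | h a < h v ∧ ∃ f ∈ P.faces, ∃ b, v ∈ polygonVertices f ∧
    PolygonCorner f v a b} with hT
  have hTfin : T.Finite := P.finite_vertices.subset fun a ha => by
    obtain ⟨-, f, hf, b, -, hc⟩ := ha
    exact polygonVertices_subset hf hc.left_mem
  set p : E3 → E3 := fun a => (h v - h a)⁻¹ • (a - v) with hp
  -- The line from `y` through `v`, continued down to the same slice: `h q = -1`.
  set q : E3 := -(h y - h v)⁻¹ • (y - v) with hq
  have hhp : ∀ a ∈ T, h (p a) = -1 := fun a ha => by
    have := (sub_pos.mpr ha.1).ne'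
    simp only [hp, map_smul, map_sub, smul_eq_mul]
    field_simp
    ring
  have hcorner_mem : ∀ {f a b}, f ∈ P.faces → v ∈ polygonVertices f → PolygonCorner f v a b →
      h a < h v → a ∈ T ∧ b ∈ T := by
    intro f a b hf hvf hc ha
    exact ⟨⟨ha, f, hf, b, hvf, hc⟩, hlow f hf hvf a hc.left_mem ha b hc.right_mem hc.symm.left_ne,
      f, hf, a, hvf, hc.symm⟩
  have hpind : ∀ {f a b}, PolygonCorner f v a b → a ∈ T → b ∈ T →
      ∀ s t : ℝ, s • p a + t • p b = 0 → s = 0 ∧ t = 0 := by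
    intro f a b hc ha hb s t hst
    have h1 := hc.indep (s * (h v - h a)⁻¹) (t * (h v - h b)⁻¹) (by
      rw [mul_smul, mul_smul]
      exact hst)
    exact ⟨(mul_eq_zero.mp h1.1).resolve_right (inv_pos.mpr (sub_pos.mpr ha.1)).ne',
      (mul_eq_zero.mp h1.2).resolve_right (inv_pos.mpr (sub_pos.mpr hb.1)).ne'⟩
  have hpne : ∀ {f a b}, PolygonCorner f v a b → a ∈ T → b ∈ T → p a ≠ p b := by
    intro f a b hc ha hb heq
    have := hpind hc ha hb 1 (-1) (by rw [heq]; module)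
    exact one_ne_zero this.1
  have hex : ∃ a ∈ T, p a ≠ q := by
    obtain ⟨a, b, hc⟩ := (P.isConvexPolygon_of_mem f₀ hf₀).exists_polygonCorner hv₀
    obtain ⟨haT, hbT⟩ := hcorner_mem hf₀ hv₀ hc
      (hlow f₀ hf₀ hv₀ x₀ hx₀ hlt₀ a hc.left_mem hc.left_ne)
    by_cases haq : p a = q
    · exact ⟨b, hbT, fun hbq => hpne hc haT hbT (haq.trans hbq.symm)⟩
    · exact ⟨a, haT, haq⟩
  -- A generic functional, with its sign chosen so that `q` does not maximize it over the slice. A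
  -- maximizing `p a` is then a corner of the slice where the faces `f` and `g` meet.
  obtain ⟨σ, hσinj, a₁, ha₁, hσa₁⟩ : ∃ σ : Module.Dual ℝ E3, Set.InjOn σ (p '' T) ∧
      ∃ a ∈ T, σ q < σ (p a) := by
    obtain ⟨ψ, hψ⟩ := exists_dual_injOn ((hTfin.image p).insert q)
    obtain ⟨a, ha, haq⟩ := hex
    have hne : ψ (p a) ≠ ψ q := fun h1 =>
      haq (hψ (Or.inr ⟨a, ha, rfl⟩) (Or.inl rfl) h1)
    rcases lt_or_gt_of_ne hne with h1 | h1
    · refine ⟨-ψ, fun z hz w hw hzw => hψ (Or.inr hz) (Or.inr hw) (by simpa using hzw), a, ha, ?_⟩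
      simpa using h1
    · exact ⟨ψ, hψ.mono (Set.subset_insert _ _), a, ha, h1⟩
  obtain ⟨a, ha, hamax⟩ := Set.exists_max_image T (fun x => σ (p x)) hTfin ⟨a₁, ha₁⟩
  have hσq : σ q < σ (p a) := hσa₁.trans_le (hamax a₁ ha₁)
  obtain ⟨hav, f, hf, b, hvf, hcf⟩ := id ha
  have hedge := hcf.segment_mem_edges (P.isConvexPolygon_of_mem f hf).convex hvf
  obtain ⟨g, hg, hfg, heg⟩ := exists_other_face hf hedge
  have hvg : v ∈ polygonVertices g := by
    obtain ⟨_, _, _, h1, h2⟩ := heg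
    exact left_mem_vertices_of_isExtreme (y := a) (h1 ▸ h2)
  obtain ⟨c, hcg⟩ := (P.isConvexPolygon_of_mem g hg).exists_polygonCorner_of_edge hvg heg
  have hb := (hcorner_mem hf hvf hcf hav).2
  have hc := (hcorner_mem hg hvg hcg hav).2
  have hlt : ∀ x ∈ T, p a ≠ p x → σ (p x) < σ (p a) := fun x hx hne =>
    lt_of_le_of_ne (hamax x hx) fun h1 => hne (hσinj ⟨a, ha, rfl⟩ ⟨x, hx, rfl⟩ h1.symm)
  have hσb := hlt b hb (hpne hcf ha hb)
  have hσc := hlt c hc (hpne hcg ha hc)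
  have hind : LinearIndependent ℝ ![p a, p b, p c] := by
    refine linearIndependent_triple fun r s t hrst => ?_
    by_cases ht : t = 0
    · subst ht
      rw [zero_smul, add_zero] at hrst
      obtain ⟨h1, h2⟩ := hpind hcf ha hb r s hrst
      exact ⟨h1, h2, rfl⟩
    exfalso
    have hs : s ≠ 0 := by
      rintro rfl
      rw [zero_smul, add_zero] at hrst
      exact ht (hpind hcg ha hc r t hrst).2
    have h1 := congrArg h hrst
    have h2 := congrArg σ hrst
    simp only [map_add, map_smul, smul_eq_mul, map_zero, hhp a ha, hhp b hb, hhp c hc] at h1 h2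
    have hr : r = -s - t := by linarith
    subst hr
    have h3 : s * (σ (p a) - σ (p b)) + t * (σ (p a) - σ (p c)) = 0 := by linarith
    -- A dependence makes `p b - p a` and `p c - p a` parallel. Both lower `σ`, so they point the
    -- same way and `f` and `g` overlap beside the edge from `v` to `a`. Negating the relation
    -- reduces to `0 < s`.
    have key : ∀ s t : ℝ, 0 < s → (-s - t) • p a + s • p b + t • p c = 0 →
        s * (σ (p a) - σ (p b)) + t * (σ (p a) - σ (p c)) = 0 → False := by
      intro s t hs hrst h3
      have ht : t < 0 := by
        by_contra! ht
        have := mul_pos hs (sub_pos.mpr hσb)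
        have := mul_nonneg ht (sub_pos.mpr hσc).le
        linarith
      have h4 : (-t) • p a + s • p b = s • p a + (-t) • p c := by
        rw [← sub_eq_zero, ← hrst]
        module
      have hia := inv_pos.mpr (sub_pos.mpr hav)
      have hib := inv_pos.mpr (sub_pos.mpr hb.1)
      have hic := inv_pos.mpr (sub_pos.mpr hc.1)
      refine not_overlap_at_edge hf hg hfg hvf hvg hcf hcg (s := -t * (h v - h a)⁻¹)
        (t := s * (h v - h b)⁻¹) (s' := s * (h v - h a)⁻¹) (t' := -t * (h v - h c)⁻¹)
        (mul_pos (by linarith) hia).le (mul_pos hs hib) (mul_pos hs hia).le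
        (mul_pos (by linarith) hic).le ?_
      simp only [mul_smul]
      exact h4
    rcases lt_or_gt_of_ne hs with hs | hs
    · refine key (-s) (-t) (by linarith) ?_ (by linarith)
      rw [← neg_eq_zero, ← hrst]
      module
    · exact key s t hs hrst h3
  obtain ⟨γ, β, δ, hcomb⟩ := exists_combination_of_linearIndependent hind (y - v)
  have hvanish : ∀ {k : Set E3} {z : E3} (l : E3 →L[ℝ] ℝ), (∀ x ∈ k, l (x - v) = 0) → z ∈ k → l (p z) = 0 := by
    intro k z l hl hz
    simp [hp, hl z hz]
  -- The supporting plane of one face kills that face's two directions and is negative on the third,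
  -- by independence; so `y` lying on the correct side fixes the sign of the third coefficient.
  have hside : ∀ {k : Set E3} {z w : E3} (l : E3 →L[ℝ] ℝ), k ∈ P.faces → l ≠ 0 → (∀ x ∈ k, l (x - v) = 0) →
      (∀ x ∈ P.surface, l (x - v) ≤ 0) → z ∈ T → (l (p z) = 0 → l = 0) →
      ∀ r : ℝ, y - v = w + r • p z → l w = 0 → 0 ≤ r := by
    intro k z w l hk hl _ hl2 hz hne r hyr hw
    have h1 : l (p z) < 0 := by
      refine lt_of_le_of_ne ?_ fun h1 => hl (hne h1)
      have hzs : z ∈ P.surface := by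
        obtain ⟨-, k', hk', _, -, hck⟩ := hz
        exact subset_surface hk' hck.left_mem.1
      simp only [hp, map_smul, smul_eq_mul]
      exact mul_nonpos_of_nonneg_of_nonpos (inv_pos.mpr (sub_pos.mpr hz.1)).le (hl2 z hzs)
    have h2 := hl2 y (vertices_subset_surface hy)
    rw [hyr, map_add, hw, map_smul, smul_eq_mul, zero_add] at h2
    nlinarith
  have hδ : 0 ≤ δ := by
    obtain ⟨l, hl, hl1, hl2⟩ := hP.exists_supporting hf hvf.1
    have hla := hvanish l hl1 hcf.left_mem.1
    have hlb := hvanish l hl1 hcf.right_mem.1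
    exact hside l hf hl hl1 hl2 hc (fun h1 => eq_zero_of_linearIndependent hind hla hlb h1) δ hcomb
      (by simp [hla, hlb])
  have hβ : 0 ≤ β := by
    obtain ⟨l, hl, hl1, hl2⟩ := hP.exists_supporting hg hvg.1
    have hla := hvanish l hl1 hcg.left_mem.1
    have hlc := hvanish l hl1 hcg.right_mem.1
    exact hside (w := γ • p a + δ • p c) l hg hl hl1 hl2 hb
      (fun h1 => eq_zero_of_linearIndependent hind hla h1 hlc) β (by rw [hcomb]; abel)
      (by simp [hla, hlc])
  -- The functional `σ + σ (p a) • h` kills `p a` and is negative at `p b` and `p c`, so it is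
  -- nonpositive at `y - v`. But `y - v` is a negative multiple of `q`, where it is negative because
  -- `σ q < σ (p a)`.
  have h1 := congrArg h hcomb
  have h2 := congrArg σ hcomb
  have hyq : y - v = -(h y - h v) • q := by
    rw [hq, smul_smul, neg_mul_neg, mul_inv_cancel₀ (sub_pos.mpr hvy).ne', one_smul]
  rw [hyq, map_smul] at h2
  simp only [map_add, map_smul, map_sub, smul_eq_mul, hhp a ha, hhp b hb, hhp c hc] at h1 h2
  have h3 := mul_pos (sub_pos.mpr hvy) (sub_pos.mpr hσq)
  have h4 := mul_nonneg hβ (sub_pos.mpr hσb).le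
  have h5 := mul_nonneg hδ (sub_pos.mpr hσc).le
  have h6 : γ = -(h y - h v) - β - δ := by linarith
  subst h6
  linarith

/-- The number is even and at most two, so only zero has to be excluded. Any side at `v` goes down
or up; accordingly zero would make `v` a highest or, applying the same lemma to `-h`, a lowest
vertex. -/
theorem IsConvex.ncard_midVertices_eq_two (hP : P.IsConvex) {h : Module.Dual ℝ E3}
    (hinj : Set.InjOn h P.vertices) {v : E3} (hv : v ∈ P.vertices)
    (hlow : ∃ x ∈ P.vertices, h x < h v) (hhigh : ∃ y ∈ P.vertices, h v < h y) :
    {f | f ∈ P.faces ∧ v ∈ midVertices h f}.ncard = 2 := by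
  have h1 := hP.ncard_midVertices_le_two hinj v
  have h2 := P.even_ncard_midVertices hinj hv
  have hfin : {f | f ∈ P.faces ∧ v ∈ midVertices h f}.Finite :=
    P.faces.finite_toSet.subset fun f hf => hf.1
  have h3 : {f | f ∈ P.faces ∧ v ∈ midVertices h f}.ncard ≠ 0 := by
    rw [Ne, Set.ncard_eq_zero hfin]
    intro hempty
    have hmid : ∀ f ∈ P.faces, v ∉ midVertices h f := fun f hf hvf =>
      Set.eq_empty_iff_forall_notMem.mp hempty f ⟨hf, hvf⟩
    obtain ⟨f, hf, hvf⟩ := Set.mem_iUnion₂.mp hv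
    obtain ⟨a, b, hc⟩ := (P.isConvexPolygon_of_mem f hf).exists_polygonCorner hvf
    have hne : h a ≠ h v := fun heq => hc.left_ne
      (hinj (polygonVertices_subset hf hc.left_mem) hv heq)
    rcases lt_or_gt_of_ne hne with hav | hav
    · obtain ⟨y, hy, hvy⟩ := hhigh
      exact absurd (hP.le_of_forall_notMem_midVertices hinj hmid hf hvf hc.left_mem hav hy)
        (not_le.mpr hvy)
    · obtain ⟨x, hx, hxv⟩ := hlow
      have hmid' : ∀ f ∈ P.faces, v ∉ midVertices (-h) f := by
        rintro f hf ⟨h4, ⟨z, hz, hzv⟩, w, hw, hwv⟩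
        exact hmid f hf ⟨h4, ⟨w, hw, by simpa using hwv⟩, z, hz, by simpa using hzv⟩
      have h4 := hP.le_of_forall_notMem_midVertices (h := -h)
        (fun z hz w hw hzw => hinj hz hw (by simpa using hzw)) hmid' hf hvf hc.left_mem
        (by simpa using hav) hx
      simp at h4
      linarith
  obtain ⟨k, hk⟩ := h2
  omega

/-! ### Double counting and the formula -/

theorem sum_ncard_edges (P : Polyhedron) :
    ∑ f ∈ P.faces, (polygonEdges f).ncard = 2 * P.edges.ncard := by
  classical
  have h := Finset.sum_card_bipartiteAbove_eq_sum_card_bipartiteBelow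
    (s := P.faces) (t := P.finite_edges.toFinset) (fun f e => e ∈ polygonEdges f)
  have h1 : ∀ e ∈ P.finite_edges.toFinset,
      (P.faces.bipartiteBelow (fun f e => e ∈ polygonEdges f) e).card = 2 := by
    intro e he
    rw [← P.two_faces_of_edge e (P.finite_edges.mem_toFinset.mp he), ← Set.ncard_coe_finset]
    congr 1
    ext f
    simp
  have h2 : ∀ f ∈ P.faces, (P.finite_edges.toFinset.bipartiteAbove
      (fun f e => e ∈ polygonEdges f) f).card = (polygonEdges f).ncard := by
    intro f hf
    rw [← Set.ncard_coe_finset]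
    congr 1
    ext e
    simpa using fun he => polygonEdges_subset hf he
  rw [Finset.sum_congr rfl h1, Finset.sum_congr rfl h2, Finset.sum_const, smul_eq_mul,
    ← Set.ncard_eq_toFinset_card _ P.finite_edges] at h
  rw [h, mul_comm]

theorem sum_ncard_midVertices (P : Polyhedron) (h : Module.Dual ℝ E3) :
    ∑ v ∈ P.finite_vertices.toFinset, {f | f ∈ P.faces ∧ v ∈ midVertices h f}.ncard =
      ∑ f ∈ P.faces, (midVertices h f).ncard := by
  classical
  have h0 := Finset.sum_card_bipartiteAbove_eq_sum_card_bipartiteBelow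
    (s := P.finite_vertices.toFinset) (t := P.faces) (fun v f => v ∈ midVertices h f)
  refine (Finset.sum_congr rfl fun v _ => ?_).trans (h0.trans (Finset.sum_congr rfl fun f hf => ?_))
  · rw [← Set.ncard_coe_finset]
    congr 1
    ext f
    simp
  · rw [← Set.ncard_coe_finset]
    congr 1
    ext v
    simpa using fun hv : v ∈ midVertices h f => polygonVertices_subset hf hv.1

/-- Only the highest and the lowest vertex do not lie in the middle of exactly two faces. -/
theorem IsConvex.sum_ncard_midVertices_add_four (hP : P.IsConvex) {h : Module.Dual ℝ E3}
    (hinj : Set.InjOn h P.vertices) :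
    ∑ v ∈ P.finite_vertices.toFinset, {f | f ∈ P.faces ∧ v ∈ midVertices h f}.ncard + 4 =
      2 * P.vertices.ncard := by
  classical
  obtain ⟨f, hf⟩ := P.faces_nonempty
  have hpoly := P.isConvexPolygon_of_mem f hf
  obtain ⟨v, hv, -⟩ := hpoly.exists_vertex_not_mem_span 0 0
  obtain ⟨a, b, hc⟩ := hpoly.exists_polygonCorner hv
  have haV := polygonVertices_subset hf hc.left_mem
  have hbV := polygonVertices_subset hf hc.right_mem
  obtain ⟨x, hx, hxmax⟩ := Set.exists_max_image _ h P.finite_vertices ⟨a, haV⟩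
  obtain ⟨y, hy, hymin⟩ := Set.exists_min_image _ h P.finite_vertices ⟨a, haV⟩
  have hxy : y ≠ x := by
    rintro rfl
    exact hc.left_ne_right (hinj haV hbV (by
      linarith [hxmax a haV, hymin a haV, hxmax b hbV, hymin b hbV]))
  have hzero : ∀ w, (∀ f ∈ P.faces, w ∉ midVertices h f) →
      {f | f ∈ P.faces ∧ w ∈ midVertices h f}.ncard = 0 := by
    intro w hw
    have : {f | f ∈ P.faces ∧ w ∈ midVertices h f} = ∅ :=
      Set.eq_empty_iff_forall_notMem.mpr fun f hf => hw f hf.1 hf.2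
    rw [this, Set.ncard_empty]
  have hx0 := hzero x (by
    rintro f hf ⟨-, -, z, hz, hlt⟩
    exact absurd (hxmax z (polygonVertices_subset hf hz)) (not_le.mpr hlt))
  have hy0 := hzero y (by
    rintro f hf ⟨-, ⟨z, hz, hlt⟩, -⟩
    exact absurd (hymin z (polygonVertices_subset hf hz)) (not_le.mpr hlt))
  have hxf : x ∈ P.finite_vertices.toFinset := P.finite_vertices.mem_toFinset.mpr hx
  have hyf : y ∈ P.finite_vertices.toFinset.erase x :=
    Finset.mem_erase.mpr ⟨hxy, P.finite_vertices.mem_toFinset.mpr hy⟩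
  have hrest : ∀ w ∈ (P.finite_vertices.toFinset.erase x).erase y,
      {f | f ∈ P.faces ∧ w ∈ midVertices h f}.ncard = 2 := by
    intro w hw
    simp only [Finset.mem_erase, Set.Finite.mem_toFinset] at hw
    obtain ⟨hwy, hwx, hw⟩ := hw
    exact hP.ncard_midVertices_eq_two hinj hw
      ⟨y, hy, lt_of_le_of_ne (hymin w hw) fun h1 => hwy (hinj hw hy h1.symm)⟩
      ⟨x, hx, lt_of_le_of_ne (hxmax w hw) fun h1 => hwx (hinj hw hx h1)⟩
  -- The highest and lowest vertices contribute `0` and all others `2`; the `4` in the statement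
  -- makes up for these two vertices without truncated subtraction.
  rw [← Finset.add_sum_erase _ _ hxf, ← Finset.add_sum_erase _ _ hyf, hx0, hy0,
    Finset.sum_congr rfl hrest, Finset.sum_const, smul_eq_mul,
    Set.ncard_eq_toFinset_card _ P.finite_vertices]
  have h1 := Finset.card_erase_add_one hxf
  have h2 := Finset.card_erase_add_one hyf
  omega

end Polyhedron

theorem mainTheorem2 (P : Polyhedron) (hP : P.IsConvex) :
    (P.vertices.ncard : ℤ) - (P.edges.ncard : ℤ) + (P.faces.card : ℤ) = 2 := by
  obtain ⟨h, hinj⟩ := exists_dual_injOn P.finite_vertices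
  have h1 := hP.sum_ncard_midVertices_add_four hinj
  rw [P.sum_ncard_midVertices] at h1
  -- Restoring the highest and lowest vertex of each face turns the count of middle vertices into
  -- the count of sides, where each edge appears twice.
  have h2 : ∑ f ∈ P.faces, ((midVertices h f).ncard + 2) = 2 * P.edges.ncard := by
    rw [← P.sum_ncard_edges]
    refine Finset.sum_congr rfl fun f hf => ?_
    have hpoly := P.isConvexPolygon_of_mem f hf
    rw [hpoly.ncard_edges,
      hpoly.ncard_midVertices (hinj.mono (Polyhedron.polygonVertices_subset hf))]
  rw [Finset.sum_add_distrib, Finset.sum_const, smul_eq_mul] at h2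
  omega
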